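/- Let $1=m_1<m_2<m_3<\cdots$ be a strictly increasing sequence of positive integers. For integers $j,j'\ge 1$ write $j'\preceq j$ if either there is $k\ge1$ with $j'<m_k\le j$, or there is $k\ge 1$ such that both $j$ and $j'$ lie in $[m_k,m_{k+1})$. Let $\overline{\mathcal S}_{\vec m}$ be the monoid $$\overline{\mathcal S}_{\vec m}=\langle x,y \mid x^2=x,\ \ xy^jxy^{j'}x=xy^jx \text{ for all } j,j'\ge1 \text{ with } j'\preceq j\rangle .$$ For $a\in\overline{\mathcal S}_{\vec m}$ let $|a|$ be the least $k\ge0$ such that $a$ is a product of $k$ elements of $\{x,y\}$. Let $R_n=X_1\cdots X_n$ $(n\ge0)$ be the simple random walk on $\overline{\mathcal S}_{\vec m}$, where $X_1,X_2,\dots$ are independent and uniformly distributed on $\{x,y\}$. There is a universal constant $c_0>0$, depending neither on the sequence $\vec m$ nor on $n$, such that for every such sequence $\vec m$ and every $n\ge 0$, $$c_0\sum_{k:\,m_k\le\log_2 n}(m_k+1)\ \le\ \mathbb E|R_n|\ \le\ \sum_{k:\,m_k\le n-2}(m_k+2)\min\Big\{1,\frac{n}{2^{m_k}}\Big\}+3,$$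 where for $n=0$ the sum on the left is empty. -/

import Mathlib

open MeasureTheory ProbabilityTheory

/-! ### Word length and simple random walks in a finitely generated monoid -/

/-- The word length `|a| = inf {k | ∃ t₁, …, t_k ∈ T, a = t₁ ⋯ t_k}` of `a` with respect to `T`. -/
noncomputable def wordLength {S : Type*} [Monoid S] (T : Set S) (a : S) : ℕ :=
  sInf {k : ℕ | ∃ l : List S, l.length = k ∧ (∀ t ∈ l, t ∈ T) ∧ l.prod = a}

/-- `R` is a simple (right) random walk on the (discrete) monoid `S` with respect to the finite
set `T`: there are i.i.d. `X 0, X 1, …`, uniformly distributed on `T`, such that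
`R n = X 0 * X 1 * ⋯ * X (n - 1)` for all `n`. -/
def IsSimpleRandomWalk {S : Type*} [Monoid S] [MeasurableSpace S] [DiscreteMeasurableSpace S]
    (T : Set S) {Ω : Type*} [MeasurableSpace Ω] (μ : Measure Ω) (R : ℕ → Ω → S) : Prop :=
  ∃ X : ℕ → Ω → S,
    (∀ i, Measurable (X i)) ∧ iIndepFun X μ ∧ (∀ i, μ.map (X i) = uniformOn T) ∧
      ∀ n ω, R n ω = (List.ofFn (fun i : Fin n => X i ω)).prod

/-! ### The monoid `S̄_m`

The sequence `m₁ < m₂ < ⋯` is indexed from `0` here: `m k` stands for `m_{k+1}`. -/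

/-- `j' ≺ j`: some `m k` satisfies `j' < m k ≤ j`. -/
def Prec (m : ℕ → ℕ) (j' j : ℕ) : Prop :=
  ∃ k, j' < m k ∧ m k ≤ j

/-- `j' ⪯ j`: either `j' ≺ j`, or `j` and `j'` lie in a common interval `[m k, m (k + 1))`. -/
def Preceq (m : ℕ → ℕ) (j' j : ℕ) : Prop :=
  Prec m j' j ∨ ∃ k, (m k ≤ j ∧ m k ≤ j') ∧ (j < m (k + 1) ∧ j' < m (k + 1))

/-- The two-letter alphabet. -/
inductive Letter : Type
  | x : Letter
  | y : Letter

/-- The letter `x` as a word. -/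
def wx : FreeMonoid Letter := FreeMonoid.of Letter.x

/-- The letter `y` as a word. -/
def wy : FreeMonoid Letter := FreeMonoid.of Letter.y

/-- The defining relations: `x² = x`, and `x y^j x y^{j'} x = x y^j x` whenever `j' ⪯ j`. -/
inductive SbarRel (m : ℕ → ℕ) : FreeMonoid Letter → FreeMonoid Letter → Prop
  | idem : SbarRel m (wx * wx) wx
  | absorb (j j' : ℕ) (hj : 1 ≤ j) (hj' : 1 ≤ j') (h : Preceq m j' j) :
      SbarRel m (wx * wy ^ j * wx * wy ^ j' * wx) (wx * wy ^ j * wx)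

/-- The monoid `S̄_m = ⟨x, y | x² = x, x y^j x y^{j'} x = x y^j x (j' ⪯ j)⟩`. -/
abbrev Sbar (m : ℕ → ℕ) : Type := PresentedMonoid (SbarRel m)

/-- The generator `x` of `S̄_m`. -/
def Sbar.x (m : ℕ → ℕ) : Sbar m := PresentedMonoid.of (SbarRel m) Letter.x

/-- The generator `y` of `S̄_m`. -/
def Sbar.y (m : ℕ → ℕ) : Sbar m := PresentedMonoid.of (SbarRel m) Letter.y

/-- The generating set `{x, y}` of `S̄_m`. -/
def Sbar.gens (m : ℕ → ℕ) : Set (Sbar m) := {Sbar.x m, Sbar.y m}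

/-- `S̄_m` carries the discrete `σ`-algebra. -/
instance Sbar.instMeasurableSpace (m : ℕ → ℕ) : MeasurableSpace (Sbar m) := ⊤

instance Sbar.instDiscreteMeasurableSpace (m : ℕ → ℕ) : DiscreteMeasurableSpace (Sbar m) :=
  ⟨fun _ => trivial⟩

/-! ### The index sets of the two sums -/

/-- The finite set of indices `k` with `m_k ≤ log₂ n`. -/
noncomputable def lowerIndices (m : ℕ → ℕ) (n : ℕ) : Finset ℕ :=
  (Finset.range n).filter (fun k => (m k : ℝ) ≤ Real.logb 2 n)

/-- The finite set of indices `k` with `m_k ≤ n - 2`. -/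
def upperIndices (m : ℕ → ℕ) (n : ℕ) : Finset ℕ :=
  (Finset.range n).filter (fun k => m k + 2 ≤ n)

/-- The bound `k < n` in `lowerIndices` is no restriction. -/
theorem mem_lowerIndices {m : ℕ → ℕ} (hm : StrictMono m) (h0 : m 0 = 1) (n k : ℕ) :
    k ∈ lowerIndices m n ↔ (m k : ℝ) ≤ Real.logb 2 n := by
  simp only [lowerIndices, Finset.mem_filter, Finset.mem_range, and_iff_right_iff_imp]
  intro h
  have h1 : k ≤ m k := hm.id_le k
  have h2 : 1 ≤ m k := h0 ▸ hm.monotone (Nat.zero_le k)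
  rcases Nat.eq_zero_or_pos n with rfl | hn
  · simp at h
    omega
  · have hn' : (0 : ℝ) < n := by exact_mod_cast hn
    rw [Real.le_logb_iff_rpow_le (by norm_num) hn', Real.rpow_natCast] at h
    have h3 : 2 ^ m k ≤ n := by exact_mod_cast h
    have h4 : m k < 2 ^ m k := Nat.lt_two_pow_self
    omega

/-- The bound `k < n` in `upperIndices` is no restriction, and `m k + 2 ≤ n` says
`m k ≤ n - 2` without truncated subtraction. -/
theorem mem_upperIndices {m : ℕ → ℕ} (hm : StrictMono m) (n k : ℕ) :
    k ∈ upperIndices m n ↔ (m k : ℤ) ≤ (n : ℤ) - 2 := by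
  have h1 : k ≤ m k := hm.id_le k
  simp only [upperIndices, Finset.mem_filter, Finset.mem_range]
  omega

/-! Call the number of thresholds `m k` not exceeding the length of a `y`-run its type. The
relations erase a run enclosed by `x`s as soon as an earlier enclosed run has at least its type. A
word thus reduces to its initial run, the enclosed runs whose types are strict records, and its
final run. The relations preserve the data tracked by the automaton `NormalState.step`, and a letter
adds at most one to the size, so this reduced word is shortest (`Sbar.wordLength_ofWord`).

A record of type `k + 1` is the first enclosed run of length at least `m k`; with its closing `x` it
contributes its length plus one. By memorylessness this has mean at most `m k + 2`, and counting the
possible starting positions gives the extra factor `n / 2 ^ m k`. The initial run, the first `x` and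
the final run cost at most 3 on average. Conversely, if the first enclosed run of length at least `m
k` has length exactly `m k`, it is a record contributing `m k + 1`; for `m k ≥ 2` and `2 ^ m k ≤ n`
this has probability at least 1/24.

The law of the walk is replaced by averages over words, and each average is bounded by a
time-dependent super- or subharmonic function of a small automaton. -/

/-! ### The type of a run of `y`s -/

/-- The number of indices `k` with `m k ≤ c`, for a strictly increasing sequence `m`. -/
noncomputable def runType (m : ℕ → ℕ) (c : ℕ) : ℕ := sInf {k | c < m k}

theorem lt_runType_iff {m : ℕ → ℕ} (hm : StrictMono m) {k c : ℕ} :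
    k < runType m c ↔ m k ≤ c := by
  constructor
  · intro h
    simpa using Nat.notMem_of_lt_sInf h
  · intro h
    -- Nonemptiness rules out the default value 0 of `sInf`; strict monotonicity gives `m (c + 1) ≥
    -- c + 1`.
    have hne : {k | c < m k}.Nonempty := ⟨c + 1, lt_of_lt_of_le (Nat.lt_succ_self c) (hm.id_le _)⟩
    have h1 : c < m (runType m c) := Nat.sInf_mem hne
    exact hm.lt_iff_lt.mp (lt_of_le_of_lt h h1)

theorem runType_le_iff {m : ℕ → ℕ} (hm : StrictMono m) {k c : ℕ} :
    runType m c ≤ k ↔ c < m k := by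
  rw [← not_lt, lt_runType_iff hm, not_le]

theorem runType_zero {m : ℕ → ℕ} (hm : StrictMono m) (h0 : m 0 = 1) : runType m 0 = 0 := by
  rw [← Nat.le_zero, runType_le_iff hm, h0]
  exact Nat.one_pos

/-- Since `m 0 = 1`, each `j ≥ 1` lies in exactly one interval `[m k, m (k + 1))`, the one with `k +
1` equal to its type. The relation is therefore a comparison of types, in particular a total
preorder on positive lengths. -/
theorem preceq_iff_runType_le {m : ℕ → ℕ} (hm : StrictMono m) (h0 : m 0 = 1) {j j' : ℕ}
    (hj : 1 ≤ j) : Preceq m j' j ↔ runType m j' ≤ runType m j := by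
  constructor
  · rintro (⟨k, h1, h2⟩ | ⟨k, ⟨h1, h2⟩, h3, h4⟩)
    · exact ((runType_le_iff hm).2 h1).trans ((lt_runType_iff hm).2 h2).le
    · exact ((runType_le_iff hm).2 h4).trans ((lt_runType_iff hm).2 h1)
  · intro h
    obtain ⟨k, hk⟩ : ∃ k, runType m j = k + 1 :=
      Nat.exists_eq_succ_of_ne_zero ((lt_runType_iff hm).2 (by rw [h0]; exact hj)).ne'
    have h1 : m k ≤ j := (lt_runType_iff hm).1 (by omega)
    have h2 : j < m (k + 1) := (runType_le_iff hm).1 hk.le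
    have h3 : j' < m (k + 1) := (runType_le_iff hm).1 (hk ▸ h)
    by_cases h4 : m k ≤ j'
    · exact Or.inr ⟨k, ⟨h1, h4⟩, h2, h3⟩
    · exact Or.inl ⟨k, not_le.1 h4, h1⟩

/-! ### The normal form automaton -/

/-- The data of a normal form: `pre a` stands for `y ^ a`, and `post B M c` for `u * y ^ c`, where
the word `u` has length `B`, ends in `x`, and `M` is the largest type of a run in `u`. -/
inductive NormalState : Type
  | pre (a : ℕ) : NormalState
  | post (B M c : ℕ) : NormalState

namespace NormalState

/-- Right multiplication of a normal form by a letter. -/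
noncomputable def step (m : ℕ → ℕ) : NormalState → Letter → NormalState
  | pre a, Letter.x => post (a + 1) 0 0
  | pre a, Letter.y => pre (a + 1)
  | post B M c, Letter.x =>
      if M < runType m c then post (B + c + 1) (runType m c) 0 else post B M 0
  | post B M c, Letter.y => post B M (c + 1)

/-- The length of a normal form. -/
def size : NormalState → ℕ
  | pre a => a
  | post B _ c => B + c

theorem size_step_le (m : ℕ → ℕ) (s : NormalState) (l : Letter) :
    (s.step m l).size ≤ s.size + 1 := by
  rcases s with a | ⟨B, M, c⟩ <;> rcases l with _ | _ <;> simp only [step]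
  · exact le_rfl
  · exact le_rfl
  · split_ifs <;> simp only [size] <;> omega
  · simp only [size]
    omega

/-- The normal form of a word. -/
noncomputable def ofWord (m : ℕ → ℕ) (w : List Letter) : NormalState := w.foldl (step m) (pre 0)

@[simp] theorem ofWord_nil (m : ℕ → ℕ) : ofWord m [] = pre 0 := rfl

@[simp] theorem ofWord_append_singleton (m : ℕ → ℕ) (w : List Letter) (l : Letter) :
    ofWord m (w ++ [l]) = (ofWord m w).step m l := by
  simp [ofWord]

theorem size_ofWord_le (m : ℕ → ℕ) (w : List Letter) : (ofWord m w).size ≤ w.length := by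
  induction w using List.reverseRecOn with
  | nil => simp [size]
  | append_singleton w l ih =>
    have := size_step_le m (ofWord m w) l
    simp only [ofWord_append_singleton, List.length_append, List.length_singleton]
    omega

/-- Right multiplication by a letter, as an element of the opposite endomorphism monoid. -/
noncomputable def letterEnd (m : ℕ → ℕ) (l : Letter) : (Function.End NormalState)ᵐᵒᵖ :=
  MulOpposite.op (fun s => s.step m l)

theorem letterEnd_y_pow_post (m : ℕ → ℕ) (B M c j : ℕ) :
    (letterEnd m Letter.y ^ j).unop (post B M c) = post B M (c + j) := by
  induction j with
  | zero => rfl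
  | succ j ih =>
    rw [pow_succ, MulOpposite.unop_mul]
    change (letterEnd m Letter.y).unop ((letterEnd m Letter.y ^ j).unop (post B M c)) = _
    rw [ih]
    rfl

theorem exists_step_x_eq_post (m : ℕ → ℕ) (s : NormalState) :
    ∃ B M, s.step m Letter.x = post B M 0 := by
  cases s with
  | pre a => exact ⟨_, _, rfl⟩
  | post B M c =>
    simp only [step]
    split_ifs
    exacts [⟨_, _, rfl⟩, ⟨_, _, rfl⟩]

/-- After an `x` the state is `post B M 0`. A second `x` then changes nothing, because the empty run
has type 0; and after a further `y ^ j * x` the record is at least the type of `j`, so a run of no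
larger type leaves no trace. -/
theorem lift_letterEnd_eq {m : ℕ → ℕ} (hm : StrictMono m) (h0 : m 0 = 1)
    (a b : FreeMonoid Letter) (h : SbarRel m a b) :
    FreeMonoid.lift (letterEnd m) a = FreeMonoid.lift (letterEnd m) b := by
  have hz := runType_zero hm h0
  cases h with
  | idem =>
    simp only [wx, map_mul, FreeMonoid.lift_eval_of]
    apply MulOpposite.unop_injective
    funext s
    change (s.step m Letter.x).step m Letter.x = s.step m Letter.x
    obtain ⟨B, M, h⟩ := exists_step_x_eq_post m s
    rw [h]
    simp [step, hz]
  | absorb j j' hj hj' h =>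
    simp only [wx, wy, map_mul, map_pow, FreeMonoid.lift_eval_of]
    apply MulOpposite.unop_injective
    funext s
    change ((letterEnd m Letter.y ^ j').unop (((letterEnd m Letter.y ^ j).unop
      (s.step m Letter.x)).step m Letter.x)).step m Letter.x =
      ((letterEnd m Letter.y ^ j).unop (s.step m Letter.x)).step m Letter.x
    obtain ⟨B, M, hB⟩ := exists_step_x_eq_post m s
    have hle := (preceq_iff_runType_le hm h0 hj).1 h
    rw [hB, letterEnd_y_pow_post]
    simp only [step, zero_add]
    split_ifs with h1
    · rw [letterEnd_y_pow_post]
      simp only [zero_add, if_neg (not_lt.2 hle)]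
    · rw [letterEnd_y_pow_post]
      simp only [zero_add, if_neg (fun h2 => h1 (lt_of_lt_of_le h2 hle))]

end NormalState

/-! ### Word length in `S̄_m` -/

namespace Sbar

/-- The element of `S̄_m` represented by a word. -/
def ofWord (m : ℕ → ℕ) (w : List Letter) : Sbar m :=
  (w.map (PresentedMonoid.of (SbarRel m))).prod

@[simp] theorem ofWord_nil (m : ℕ → ℕ) : ofWord m [] = 1 := rfl

theorem ofWord_append (m : ℕ → ℕ) (w w' : List Letter) :
    ofWord m (w ++ w') = ofWord m w * ofWord m w' := by
  simp [ofWord]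

@[simp] theorem ofWord_x (m : ℕ → ℕ) : ofWord m [Letter.x] = x m := by simp [ofWord, x]

@[simp] theorem ofWord_y (m : ℕ → ℕ) : ofWord m [Letter.y] = y m := by simp [ofWord, y]

@[simp] theorem ofWord_replicate_y (m : ℕ → ℕ) (j : ℕ) :
    ofWord m (List.replicate j Letter.y) = y m ^ j := by simp [ofWord, y]

theorem x_mul_x (m : ℕ → ℕ) : x m * x m = x m := by
  have h := (Con.eq (conGen (SbarRel m))).2 (ConGen.Rel.of _ _ (SbarRel.idem (m := m)))
  exact h

theorem x_mul_y_pow_absorb {m : ℕ → ℕ} {j j' : ℕ} (hj : 1 ≤ j) (hj' : 1 ≤ j')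
    (h : Preceq m j' j) :
    x m * y m ^ j * x m * y m ^ j' * x m = x m * y m ^ j * x m := by
  have h := (Con.eq (conGen (SbarRel m))).2 (ConGen.Rel.of _ _ (SbarRel.absorb j j' hj hj' h))
  exact h

/-- Words that represent the same element have the same normal form. -/
theorem normalState_eq_of_ofWord_eq {m : ℕ → ℕ} (hm : StrictMono m) (h0 : m 0 = 1)
    {w w' : List Letter} (h : ofWord m w = ofWord m w') :
    NormalState.ofWord m w = NormalState.ofWord m w' := by
  have key : ∀ w : List Letter,
      (PresentedMonoid.lift (NormalState.letterEnd m) (NormalState.lift_letterEnd_eq hm h0)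
        (ofWord m w)).unop (NormalState.pre 0) = NormalState.ofWord m w := by
    intro w
    induction w using List.reverseRecOn with
    | nil => simp; rfl
    | append_singleton w l ih =>
      rw [ofWord_append, map_mul, MulOpposite.unop_mul, NormalState.ofWord_append_singleton, ← ih]
      simp only [ofWord, List.map_cons, List.map_nil, List.prod_singleton,
        PresentedMonoid.lift_of]
      rfl
  rw [← key, h, key]

theorem x_ne_y {m : ℕ → ℕ} (hm : StrictMono m) (h0 : m 0 = 1) : x m ≠ y m := by
  intro h
  rw [← ofWord_x, ← ofWord_y] at h
  have := normalState_eq_of_ofWord_eq hm h0 h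
  simp [NormalState.ofWord, NormalState.step] at this

/-- The element `g` has a normal form with data `s`. -/
def Represents (m : ℕ → ℕ) (g : Sbar m) : NormalState → Prop
  | NormalState.pre a => g = y m ^ a
  | NormalState.post B M c => ∃ u : List Letter, u.length = B ∧ g = ofWord m u * y m ^ c ∧
      ofWord m u * x m = ofWord m u ∧
      ∀ j, 1 ≤ j → runType m j ≤ M → ofWord m u * y m ^ j * x m = ofWord m u

theorem Represents.step_y {m : ℕ → ℕ} {g : Sbar m} {s : NormalState} (h : Represents m g s) :
    Represents m (g * y m) (s.step m Letter.y) := by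
  cases s with
  | pre a =>
    rw [Represents] at h
    rw [NormalState.step, Represents, h, pow_succ]
  | post B M c =>
    obtain ⟨u, hu, rfl, h1, h2⟩ := h
    exact ⟨u, hu, by rw [pow_succ, mul_assoc], h1, h2⟩

/-- The invariant is that `u` absorbs on its right `x` and every `y ^ j * x` of type at most `M`.
After the first `x` the record is 0 and the second condition is vacuous; a new record is appended to
`u` and supplies absorption up to its own type. -/
theorem Represents.step_x {m : ℕ → ℕ} (hm : StrictMono m) (h0 : m 0 = 1) {g : Sbar m}
    {s : NormalState} (h : Represents m g s) :
    Represents m (g * x m) (s.step m Letter.x) := by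
  have hpos : ∀ j, 1 ≤ j → 0 < runType m j := fun j hj => (lt_runType_iff hm).2 (by omega)
  cases s with
  | pre a =>
    rw [Represents] at h
    refine ⟨List.replicate a Letter.y ++ [Letter.x], by simp, ?_, ?_, ?_⟩
    · simp [ofWord_append, h]
    · simp [ofWord_append, mul_assoc, x_mul_x]
    · intro j hj hj'
      have := hpos j hj
      omega
  | post B M c =>
    obtain ⟨u, hu, rfl, h1, h2⟩ := h
    simp only [NormalState.step]
    split_ifs with hM
    · have hc : 1 ≤ c := by
        rcases Nat.eq_zero_or_pos c with rfl | hc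
        · rw [runType_zero hm h0] at hM
          omega
        · exact hc
      refine ⟨u ++ (List.replicate c Letter.y ++ [Letter.x]), by simp [hu, add_assoc], ?_, ?_, ?_⟩
      · simp [ofWord_append, mul_assoc]
      · simp [ofWord_append, mul_assoc, x_mul_x]
      · intro j hj hj'
        have h3 := x_mul_y_pow_absorb hc hj ((preceq_iff_runType_le hm h0 hc).2 hj')
        -- Absorption of `x` by `u` restores the left `x` that the defining relation needs.
        have h4 : ofWord m (u ++ (List.replicate c Letter.y ++ [Letter.x])) =
            ofWord m u * (x m * y m ^ c * x m) := by
          simp only [ofWord_append, ofWord_replicate_y, ofWord_x]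
          nth_rewrite 1 [← h1]
          simp only [mul_assoc]
        rw [h4]
        nth_rewrite 2 [← h3]
        simp only [mul_assoc]
    · refine ⟨u, hu, ?_, h1, h2⟩
      rcases Nat.eq_zero_or_pos c with rfl | hc
      · simp [h1]
      · rw [h2 c hc (not_lt.1 hM)]
        simp

theorem represents_ofWord {m : ℕ → ℕ} (hm : StrictMono m) (h0 : m 0 = 1) (w : List Letter) :
    Represents m (ofWord m w) (NormalState.ofWord m w) := by
  induction w using List.reverseRecOn with
  | nil => simp [Represents]
  | append_singleton w l ih =>
    rw [ofWord_append, NormalState.ofWord_append_singleton]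
    cases l
    · rw [ofWord_x]
      exact ih.step_x hm h0
    · rw [ofWord_y]
      exact ih.step_y

theorem exists_word_of_mem_gens {m : ℕ → ℕ} (l : List (Sbar m)) (hl : ∀ t ∈ l, t ∈ gens m) :
    ∃ w : List Letter, w.length = l.length ∧ ofWord m w = l.prod := by
  induction l with
  | nil => exact ⟨[], rfl, rfl⟩
  | cons t l ih =>
    obtain ⟨w, hw, h⟩ := ih fun s hs => hl s (List.mem_cons_of_mem _ hs)
    rcases hl t List.mem_cons_self with rfl | rfl
    · exact ⟨Letter.x :: w, by simp [hw], by simp [ofWord, ← h, x]⟩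
    · exact ⟨Letter.y :: w, by simp [hw], by simp [ofWord, ← h, y]⟩

theorem wordLength_ofWord_le (m : ℕ → ℕ) (w : List Letter) :
    wordLength (gens m) (ofWord m w) ≤ w.length := by
  refine Nat.sInf_le ⟨w.map (PresentedMonoid.of (SbarRel m)), by simp, ?_, rfl⟩
  intro t ht
  obtain ⟨l, -, rfl⟩ := List.mem_map.1 ht
  cases l
  exacts [Or.inl rfl, Or.inr rfl]

/-- The normal form is itself a word of length `size`, giving one inequality. For the other, any
word for the same element reaches the same state, whose size its length bounds. -/
theorem wordLength_ofWord {m : ℕ → ℕ} (hm : StrictMono m) (h0 : m 0 = 1) (w : List Letter) :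
    wordLength (gens m) (ofWord m w) = (NormalState.ofWord m w).size := by
  apply le_antisymm
  · have h := represents_ofWord hm h0 w
    generalize NormalState.ofWord m w = s at h
    cases s with
    | pre a =>
      rw [Represents] at h
      rw [h, ← ofWord_replicate_y]
      simpa [NormalState.size] using wordLength_ofWord_le m (List.replicate a Letter.y)
    | post B M c =>
      obtain ⟨u, hu, h, -⟩ := h
      rw [h, ← ofWord_replicate_y, ← ofWord_append]
      simpa [NormalState.size, hu] using wordLength_ofWord_le m (u ++ List.replicate c Letter.y)
  · have hne : {k : ℕ | ∃ l : List (Sbar m), l.length = k ∧ (∀ t ∈ l, t ∈ gens m) ∧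
        l.prod = ofWord m w}.Nonempty := by
      refine ⟨_, w.map (PresentedMonoid.of (SbarRel m)), rfl, ?_, rfl⟩
      intro t ht
      obtain ⟨l, -, rfl⟩ := List.mem_map.1 ht
      cases l
      exacts [Or.inl rfl, Or.inr rfl]
    obtain ⟨l, hl, hmem, hprod⟩ := Nat.sInf_mem hne
    obtain ⟨w', hw', h'⟩ := exists_word_of_mem_gens l hmem
    rw [← normalState_eq_of_ofWord_eq hm h0 (h'.trans hprod)]
    calc _ ≤ w'.length := NormalState.size_ofWord_le m w'
      _ = _ := by rw [hw', hl]; rfl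

instance instCountable (m : ℕ → ℕ) : Countable (Sbar m) := by
  have : Countable Letter := by
    refine Function.Injective.countable (f := fun l => match l with
      | Letter.x => true
      | Letter.y => false) ?_
    rintro (_ | _) (_ | _) <;> simp
  have : Countable (FreeMonoid Letter) := inferInstanceAs (Countable (List Letter))
  exact Function.Surjective.countable (PresentedMonoid.surjective_mk (rels := SbarRel m))

end Sbar

/-! ### Averages over words -/

/-- The average of `f` over all words of length `n`. -/
noncomputable def wordAvg : ℕ → (List Letter → ℝ) → ℝ
  | 0, f => f []
  | n + 1, f =>
      (wordAvg n (fun w => f (w ++ [Letter.x])) + wordAvg n (fun w => f (w ++ [Letter.y]))) / 2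

theorem wordAvg_mono {n : ℕ} {f g : List Letter → ℝ} (h : ∀ w, w.length = n → f w ≤ g w) :
    wordAvg n f ≤ wordAvg n g := by
  induction n generalizing f g with
  | zero => exact h [] rfl
  | succ n ih =>
    have h1 := ih (f := fun w => f (w ++ [Letter.x])) (g := fun w => g (w ++ [Letter.x]))
      fun w hw => h _ (by simp [hw])
    have h2 := ih (f := fun w => f (w ++ [Letter.y])) (g := fun w => g (w ++ [Letter.y]))
      fun w hw => h _ (by simp [hw])
    simp only [wordAvg]
    linarith

theorem wordAvg_add (n : ℕ) (f g : List Letter → ℝ) :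
    wordAvg n (fun w => f w + g w) = wordAvg n f + wordAvg n g := by
  induction n generalizing f g with
  | zero => rfl
  | succ n ih =>
    simp only [wordAvg, ih]
    ring

theorem wordAvg_const_mul (n : ℕ) (a : ℝ) (f : List Letter → ℝ) :
    wordAvg n (fun w => a * f w) = a * wordAvg n f := by
  induction n generalizing f with
  | zero => rfl
  | succ n ih =>
    simp only [wordAvg, ih]
    ring

theorem wordAvg_const (n : ℕ) (a : ℝ) : wordAvg n (fun _ => a) = a := by
  induction n with
  | zero => rfl
  | succ n ih =>
    simp only [wordAvg, ih]
    ring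

theorem wordAvg_sum {ι : Type*} (n : ℕ) (K : Finset ι) (f : ι → List Letter → ℝ) :
    wordAvg n (fun w => ∑ k ∈ K, f k w) = ∑ k ∈ K, wordAvg n (f k) := by
  classical
  induction K using Finset.induction_on with
  | empty => simp [wordAvg_const]
  | insert a K ha ih => simp only [Finset.sum_insert ha, wordAvg_add, ih]

/-- A time-dependent superharmonic function of an automaton bounds averages from above. -/
theorem wordAvg_foldl_le {σ : Type*} (step : σ → Letter → σ) (U : ℕ → σ → ℝ)
    (hU : ∀ k s, U k (step s Letter.x) + U k (step s Letter.y) ≤ 2 * U (k + 1) s)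
    (s : σ) (n k : ℕ) : wordAvg n (fun w => U k (w.foldl step s)) ≤ U (n + k) s := by
  induction n generalizing k with
  | zero => simp [wordAvg]
  | succ n ih =>
    simp only [wordAvg, ← wordAvg_add, List.foldl_append, List.foldl_cons, List.foldl_nil]
    have h1 : wordAvg n (fun w => U k (step (w.foldl step s) Letter.x)
        + U k (step (w.foldl step s) Letter.y)) ≤
        wordAvg n (fun w => 2 * U (k + 1) (w.foldl step s)) :=
      wordAvg_mono fun w _ => hU k _
    rw [wordAvg_const_mul] at h1
    have h2 := ih (k + 1)
    rw [show n + 1 + k = n + (k + 1) by ring]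
    linarith

/-- A time-dependent subharmonic function of an automaton bounds averages from below. -/
theorem le_wordAvg_foldl {σ : Type*} (step : σ → Letter → σ) (U : ℕ → σ → ℝ)
    (hU : ∀ k s, 2 * U (k + 1) s ≤ U k (step s Letter.x) + U k (step s Letter.y))
    (s : σ) (n k : ℕ) : U (n + k) s ≤ wordAvg n (fun w => U k (w.foldl step s)) := by
  have h := wordAvg_foldl_le step (fun k s => (-1) * U k s) (fun k s => by linarith [hU k s]) s n k
  rw [wordAvg_const_mul] at h
  linarith

/-! ### The first long run -/

/-- The search for the first run of `y`s of length at least `t` between two `x`s: before the first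
`x`, inside a run of current length `c`, or found, with `l - 1` the length of the run. -/
inductive ThresholdState : Type
  | start : ThresholdState
  | run (c : ℕ) : ThresholdState
  | done (l : ℕ) : ThresholdState

namespace ThresholdState

/-- Reading one letter. -/
def step (t : ℕ) : ThresholdState → Letter → ThresholdState
  | start, Letter.x => run 0
  | start, Letter.y => start
  | run c, Letter.x => if t ≤ c then done (c + 1) else run 0
  | run c, Letter.y => run (c + 1)
  | done l, _ => done l

/-- The length of the run found, plus one; zero if none has been found. -/
def gain : ThresholdState → ℕ
  | start => 0
  | run _ => 0
  | done l => l

/-- Whether the run found has length exactly `t`. -/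
def hit (t : ℕ) : ThresholdState → ℕ
  | start => 0
  | run _ => 0
  | done l => if l = t + 1 then 1 else 0

/-- The state after reading a word. -/
def ofWord (t : ℕ) (w : List Letter) : ThresholdState := w.foldl (step t) start

@[simp] theorem ofWord_nil (t : ℕ) : ofWord t [] = start := rfl

@[simp] theorem ofWord_append_singleton (t : ℕ) (w : List Letter) (l : Letter) :
    ofWord t (w ++ [l]) = (ofWord t w).step t l := by
  simp [ofWord]

theorem gain_le_gain_step (t : ℕ) (s : ThresholdState) (l : Letter) :
    s.gain ≤ (s.step t l).gain := by
  rcases s with _ | c | l' <;> simp [gain, step]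

/-- The function `U` is the mean gain with unlimited time: once a run has reached length `max c t`,
its further growth has mean 1, and the closing `x` adds 1. -/
theorem wordAvg_gain_le (t n : ℕ) :
    wordAvg n (fun w => ((ofWord t w).gain : ℝ)) ≤ t + 2 := by
  let U : ℕ → ThresholdState → ℝ := fun _ s => match s with
    | start => t + 2
    | run c => max (c : ℝ) t + 2
    | done l => l
  have h := wordAvg_foldl_le (step t) U ?_ start n 0
  · refine (wordAvg_mono fun w _ => ?_).trans h
    change ((ofWord t w).gain : ℝ) ≤ U 0 (ofWord t w)
    rcases ofWord t w with _ | c | l <;> simp only [gain, U, Nat.cast_zero] <;> first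
      | exact le_rfl
      | positivity
  · intro k s
    rcases s with _ | c | l
    · simp only [step, U, Nat.cast_zero, max_eq_right (Nat.cast_nonneg (α := ℝ) t)]
      linarith
    · simp only [step]
      split_ifs with h1
      · have h2 : (t : ℝ) ≤ c := by exact_mod_cast h1
        simp only [U, Nat.cast_add, Nat.cast_one]
        rw [max_eq_left (by linarith), max_eq_left h2]
        linarith
      · have h2 : (c : ℝ) + 1 ≤ t := by exact_mod_cast not_le.1 h1
        simp only [U, Nat.cast_add, Nat.cast_one, Nat.cast_zero]
        rw [max_eq_right h2, max_eq_right (show (c : ℝ) ≤ t by linarith),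
          max_eq_right (Nat.cast_nonneg (α := ℝ) t)]
        linarith
    · simp only [step, U]
      linarith

/-- A union bound: the current run reaches length `t` with probability `2 ^ c / 2 ^ t`, and each
remaining letter may start a successful run, at cost `1 / 2 ^ t`. Success is worth `t + 2` on
average. -/
theorem wordAvg_gain_le_mul {t : ℕ} (ht : 1 ≤ t) (n : ℕ) :
    wordAvg n (fun w => ((ofWord t w).gain : ℝ)) ≤ (t + 2) * (n / 2 ^ t) := by
  let U : ℕ → ThresholdState → ℝ := fun n s => match s with
    | start => (t + 2) * (n / 2 ^ t)
    | run c => if c < t then (t + 2) * ((n + 2 ^ c) / 2 ^ t) else c + 2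
    | done l => l
  have h := wordAvg_foldl_le (step t) U ?_ start n 0
  · refine (wordAvg_mono fun w _ => ?_).trans h
    change ((ofWord t w).gain : ℝ) ≤ U 0 (ofWord t w)
    rcases ofWord t w with _ | c | l <;> simp only [gain, U, Nat.cast_zero]
    · positivity
    · split_ifs <;> positivity
    · exact le_rfl
  · intro k s
    have hC : (0 : ℝ) ≤ (t + 2) / 2 ^ t := by positivity
    have hmul : ∀ z : ℝ, (t + 2 : ℝ) * (z / 2 ^ t) = (t + 2) / 2 ^ t * z := fun z => by ring
    have h0 : U k (run 0) = (t + 2) / 2 ^ t * (k + 1) := by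
      simp only [U, if_pos (show 0 < t by omega), hmul, pow_zero]
    rcases s with _ | c | l
    · simp only [step, h0]
      simp only [U, hmul, Nat.cast_add, Nat.cast_one]
      linarith
    · simp only [step]
      split_ifs with h1
      · simp only [U, if_neg (not_lt.2 h1), if_neg (show ¬ c + 1 < t by omega), Nat.cast_add,
          Nat.cast_one]
        linarith
      · rw [h0]
        have h2 : U (k + 1) (run c) = (t + 2) / 2 ^ t * (k + 1 + 2 ^ c) := by
          simp only [U, if_pos (not_le.1 h1), hmul, Nat.cast_add, Nat.cast_one]
        have h3 : U k (run (c + 1)) ≤ (t + 2) / 2 ^ t * (k + 2 ^ (c + 1)) := by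
          by_cases h4 : c + 1 < t
          · simp only [U, if_pos h4, hmul, le_refl]
          · have h5 : c + 1 = t := by omega
            simp only [U, if_neg h4]
            rw [h5, mul_add, div_mul_cancel₀ _ (by positivity)]
            have : (0 : ℝ) ≤ (t + 2) / 2 ^ t * k := by positivity
            linarith
        rw [h2]
        refine (add_le_add le_rfl h3).trans ?_
        rw [← mul_add, mul_left_comm]
        refine mul_le_mul_of_nonneg_left ?_ hC
        rw [pow_succ]
        linarith
    · simp only [step, U]
      linarith

/-- An auxiliary linear function of time, stopped at time `2 ^ t`. -/
noncomputable def ramp (t n : ℕ) : ℝ := ((min n (2 ^ t) - (t + 1) : ℕ) : ℝ) / 2 ^ (t + 1)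

theorem ramp_zero (t : ℕ) : ramp t 0 = 0 := by simp [ramp]

theorem ramp_le (t n : ℕ) : ramp t n ≤ 1 / 2 := by
  rw [ramp, div_le_iff₀ (by positivity), pow_succ]
  have h : ((min n (2 ^ t) - (t + 1) : ℕ) : ℝ) ≤ ((2 ^ t : ℕ) : ℝ) := by
    exact_mod_cast (Nat.sub_le _ _).trans (min_le_right _ _)
  push_cast at h
  linarith

theorem ramp_succ_le (t n : ℕ) :
    2 * ramp t (n + 1) ≤ 2 * ramp t n + if t + 1 ≤ n then 1 / 2 ^ t else 0 := by
  have hp : (0 : ℝ) < 2 ^ t := by positivity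
  have h : ∀ k, 2 * ramp t k = ((min k (2 ^ t) - (t + 1) : ℕ) : ℝ) / 2 ^ t := fun k => by
    rw [ramp, pow_succ]
    field_simp
  rw [h, h]
  split_ifs with hn
  · rw [← add_div]
    gcongr
    norm_cast
    omega
  · have : min (n + 1) (2 ^ t) - (t + 1) = 0 := by omega
    rw [this, Nat.cast_zero, zero_div]
    positivity

/-- In `U`, the term `2 ^ c / 2 ^ t` accounts for completing the current run, counted only if enough
letters remain to reach length `t` and read the closing `x`; `ramp` accounts for later runs. At `c =
t` the next letter decides, with probability 1/2; beyond `t` an exact hit is impossible. -/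
theorem le_wordAvg_hit {t n : ℕ} (ht : 2 ≤ t) (hn : 2 ^ t ≤ n) :
    1 / 24 ≤ wordAvg n (fun w => ((ofWord t w).hit t : ℝ)) := by
  let U : ℕ → ThresholdState → ℝ := fun n s => match s with
    | start => ramp t n / 3
    | run c =>
        if c < t then (ramp t n + if t + 1 ≤ c + n then 2 ^ c / 2 ^ t else 0) / 3
        else if c = t then (if n = 0 then 0 else 1 / 2) else 0
    | done l => (hit t (done l) : ℝ)
  have h := le_wordAvg_foldl (step t) U ?_ start n 0
  · refine le_trans ?_ (h.trans (wordAvg_mono fun w _ => ?_))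
    · simp only [U, add_zero, ramp, min_eq_right hn]
      -- This makes `ramp` at least 1/8 at time `2 ^ t`, whence 1/24 after division by 3. It fails
      -- for `t = 1`.
      have h1 : 4 * (t + 1) ≤ 3 * 2 ^ t := by
        clear * - ht
        induction t, ht using Nat.le_induction with
        | base => norm_num
        | succ t ht ih => rw [pow_succ]; omega
      rw [div_div, div_le_div_iff₀ (by norm_num) (by positivity), pow_succ, Nat.cast_sub (by omega)]
      have h2 : (4 * (t + 1) : ℝ) ≤ 3 * 2 ^ t := by exact_mod_cast h1
      push_cast
      linarith
    · change U 0 (ofWord t w) ≤ ((ofWord t w).hit t : ℝ)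
      rcases ofWord t w with _ | c | l <;> simp only [U, ramp_zero, hit, Nat.cast_zero, add_zero]
      · norm_num
      · split_ifs <;> first | omega | norm_num
      · exact le_rfl
  · intro k s
    have hr := ramp_succ_le t k
    have h0 : U k (run 0) = (ramp t k + if t + 1 ≤ k then 1 / 2 ^ t else 0) / 3 := by
      simp only [U, if_pos (show 0 < t by omega), pow_zero, zero_add]
    rcases s with _ | c | l
    · simp only [step, h0]
      simp only [U]
      linarith
    · simp only [step]
      split_ifs with h1
      · rcases h1.eq_or_lt with rfl | h1
        · simp [U, hit]
        · simp only [U, if_neg (show ¬ c < t by omega), if_neg (show ¬ c = t by omega),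
            if_neg (show ¬ c + 1 < t by omega), if_neg (show ¬ c + 1 = t by omega)]
          simp
      · rw [h0]
        have h2 : U (k + 1) (run c) =
            (ramp t (k + 1) + if t + 1 ≤ c + (k + 1) then 2 ^ c / 2 ^ t else 0) / 3 := by
          simp only [U, if_pos (not_le.1 h1)]
        have h3 : (ramp t k + 2 * if t + 1 ≤ c + (k + 1) then 2 ^ c / 2 ^ t else 0) / 3 ≤
            U k (run (c + 1)) := by
          by_cases h4 : c + 1 < t
          · simp only [U, if_pos h4, show c + 1 + k = c + (k + 1) by ring, pow_succ]
            split_ifs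
            · apply le_of_eq
              ring
            · simp
          · obtain rfl : c + 1 = t := by omega
            -- Here `(ramp + 1) / 3 ≤ 1 / 2` is needed; this is why `ramp` is capped at 1/2 and `U`
            -- carries the factor 1/3.
            have h5 := ramp_le (c + 1) k
            simp only [U, lt_irrefl, if_false, if_true]
            rcases Nat.eq_zero_or_pos k with rfl | hk
            · simp [ramp_zero]
            · rw [if_pos (by omega), if_neg hk.ne', pow_succ]
              have : (2 : ℝ) ^ c / (2 ^ c * 2) = 1 / 2 := by field_simp
              rw [this]
              linarith
        rw [h2]
        linarith
    · simp only [step, U]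
      linarith

end ThresholdState

/-! ### The boundary contribution -/

/-- The length `a` of the initial run of `y`s, and after the first `x` also the length `c` of the
current run. -/
inductive BoundaryState : Type
  | pre (a : ℕ) : BoundaryState
  | post (a c : ℕ) : BoundaryState

namespace BoundaryState

/-- Reading one letter. -/
def step : BoundaryState → Letter → BoundaryState
  | pre a, Letter.x => post a 0
  | pre a, Letter.y => pre (a + 1)
  | post a _, Letter.x => post a 0
  | post a c, Letter.y => post a (c + 1)

/-- The contribution to the length. -/
def size : BoundaryState → ℕ
  | pre a => a
  | post a c => a + 1 + c

/-- The state after reading a word. -/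
def ofWord (w : List Letter) : BoundaryState := w.foldl step (pre 0)

@[simp] theorem ofWord_nil : ofWord [] = pre 0 := rfl

@[simp] theorem ofWord_append_singleton (w : List Letter) (l : Letter) :
    ofWord (w ++ [l]) = (ofWord w).step l := by
  simp [ofWord]

/-- The initial run has mean at most 1, the first `x` counts 1, and the mean of the current run
relaxes to 1 as `1 + (c - 1) / 2 ^ n`. -/
theorem wordAvg_size_le (n : ℕ) : wordAvg n (fun w => ((ofWord w).size : ℝ)) ≤ 3 := by
  let U : ℕ → BoundaryState → ℝ := fun n s => match s with
    | pre a => a + 3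
    | post a c => a + 2 + (c - 1) / 2 ^ n
  have h := wordAvg_foldl_le step U ?_ (pre 0) n 0
  · refine (wordAvg_mono fun w _ => ?_).trans (h.trans ?_)
    · change ((ofWord w).size : ℝ) ≤ U 0 (ofWord w)
      rcases ofWord w with a | ⟨a, c⟩ <;> simp only [size, U, pow_zero] <;> push_cast <;> linarith
    · simp [U]
  · intro k s
    have hp : (0 : ℝ) < 2 ^ k := by positivity
    rcases s with a | ⟨a, c⟩ <;> simp only [step, U] <;> push_cast
    · have : (0 : ℝ) < 1 / 2 ^ k := by positivity
      have h2 : ((0 : ℝ) - 1) / 2 ^ k = - (1 / 2 ^ k) := by ring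
      linarith
    · apply le_of_eq
      rw [pow_succ]
      field_simp
      ring

end BoundaryState

/-! ### Decomposition of the length of the normal form -/

/-- The state of the search with threshold `m k` in terms of the normal form. -/
theorem thresholdState_of_normalState {m : ℕ → ℕ} (hm : StrictMono m) (w : List Letter) :
    match NormalState.ofWord m w with
    | NormalState.pre _ => ∀ k, ThresholdState.ofWord (m k) w = ThresholdState.start
    | NormalState.post _ M c => c + 1 ≤ w.length ∧
        (∀ k, M ≤ k → ThresholdState.ofWord (m k) w = ThresholdState.run c) ∧
        ∀ k, k < M → ∃ l, ThresholdState.ofWord (m k) w = ThresholdState.done l := by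
  induction w using List.reverseRecOn with
  | nil => simp
  | append_singleton w l ih =>
    simp only [NormalState.ofWord_append_singleton, ThresholdState.ofWord_append_singleton,
      List.length_append, List.length_singleton]
    generalize NormalState.ofWord m w = s at ih
    rcases s with a | ⟨B, M, c⟩ <;> rcases l with _ | _ <;> simp only [NormalState.step]
    · refine ⟨by omega, fun k _ => by simp [ih, ThresholdState.step], fun k hk => by omega⟩
    · exact fun k => by simp [ih, ThresholdState.step]
    · obtain ⟨h1, h2, h3⟩ := ih
      have h4 : ∀ k, k < M → ∃ l,
          (ThresholdState.ofWord (m k) w).step (m k) Letter.x = ThresholdState.done l := by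
        intro k hk
        obtain ⟨l, hl⟩ := h3 k hk
        exact ⟨l, by rw [hl]; rfl⟩
      split_ifs with hM
      · refine ⟨by omega, fun k hk => ?_, fun k hk => ?_⟩
        · rw [h2 k (by omega)]
          exact if_neg (not_le.2 ((runType_le_iff hm).1 hk))
        · rcases lt_or_ge k M with hk' | hk'
          · exact h4 k hk'
          · rw [h2 k hk']
            exact ⟨c + 1, if_pos ((lt_runType_iff hm).1 hk)⟩
      · refine ⟨by omega, fun k hk => ?_, h4⟩
        rw [h2 k hk]
        exact if_neg (not_le.2 ((runType_le_iff hm).1 (by omega)))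
    · obtain ⟨h1, h2, h3⟩ := ih
      refine ⟨by omega, fun k hk => by rw [h2 k hk]; rfl, fun k hk => ?_⟩
      obtain ⟨l, hl⟩ := h3 k hk
      exact ⟨l, by rw [hl]; rfl⟩

/-- Each new record of type `k + 1` is charged to the search with threshold `m k`, which ends at
that very run with gain `c + 1`; the other gains never decrease. -/
theorem boundaryState_of_normalState {m : ℕ → ℕ} (hm : StrictMono m) {n : ℕ}
    {K : Finset ℕ} (hK : ∀ k, m k + 2 ≤ n → k ∈ K) (w : List Letter) (hw : w.length ≤ n) :
    match NormalState.ofWord m w with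
    | NormalState.pre a => BoundaryState.ofWord w = BoundaryState.pre a
    | NormalState.post B _ c => ∃ a, BoundaryState.ofWord w = BoundaryState.post a c ∧
        B ≤ a + 1 + ∑ k ∈ K, (ThresholdState.ofWord (m k) w).gain := by
  induction w using List.reverseRecOn with
  | nil => simp
  | append_singleton w l ih =>
    simp only [List.length_append, List.length_singleton] at hw
    have ih := ih (by omega)
    have hT := thresholdState_of_normalState hm w
    have hmono : ∑ k ∈ K, (ThresholdState.ofWord (m k) w).gain ≤
        ∑ k ∈ K, ((ThresholdState.ofWord (m k) w).step (m k) l).gain :=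
      Finset.sum_le_sum fun k _ => ThresholdState.gain_le_gain_step _ _ _
    simp only [NormalState.ofWord_append_singleton, ThresholdState.ofWord_append_singleton,
      BoundaryState.ofWord_append_singleton]
    generalize NormalState.ofWord m w = s at ih hT
    rcases s with a | ⟨B, M, c⟩ <;> rcases l with _ | _ <;> simp only [NormalState.step]
    · exact ⟨a, by rw [ih]; rfl, by omega⟩
    · rw [ih]
      rfl
    · obtain ⟨a, ha, hB⟩ := ih
      obtain ⟨hlen, hrun, -⟩ := hT
      split_ifs with hM
      · refine ⟨a, by rw [ha]; rfl, ?_⟩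
        obtain ⟨k, hk⟩ := Nat.exists_eq_succ_of_ne_zero (Nat.ne_of_gt (Nat.zero_lt_of_lt hM))
        have hkc : m k ≤ c := (lt_runType_iff hm).1 (by omega)
        -- The run of length `c ≥ m k` is preceded by an `x` and followed by the new one, so `m k +
        -- 2 ≤ n`.
        have hkK : k ∈ K := hK k (by omega)
        have hsum : ∑ i ∈ K, ((ThresholdState.ofWord (m i) w).gain + if i = k then c + 1 else 0) ≤
            ∑ i ∈ K, ((ThresholdState.ofWord (m i) w).step (m i) Letter.x).gain := by
          refine Finset.sum_le_sum fun i _ => ?_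
          split_ifs with hi
          · subst hi
            rw [hrun i (by omega)]
            simp [ThresholdState.step, ThresholdState.gain, hkc]
          · exact ThresholdState.gain_le_gain_step _ _ _
        rw [Finset.sum_add_distrib, Finset.sum_ite_eq' K k, if_pos hkK] at hsum
        omega
      · exact ⟨a, by rw [ha]; rfl, by omega⟩
    · obtain ⟨a, ha, hB⟩ := ih
      exact ⟨a, by rw [ha]; rfl, by omega⟩

theorem size_ofWord_le_boundary_add_gain {m : ℕ → ℕ} (hm : StrictMono m) {n : ℕ}
    {K : Finset ℕ} (hK : ∀ k, m k + 2 ≤ n → k ∈ K) (w : List Letter) (hw : w.length ≤ n) :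
    (NormalState.ofWord m w).size ≤
      (BoundaryState.ofWord w).size + ∑ k ∈ K, (ThresholdState.ofWord (m k) w).gain := by
  have h := boundaryState_of_normalState hm hK w hw
  generalize NormalState.ofWord m w = s at h
  rcases s with a | ⟨B, M, c⟩
  · rw [h]
    exact Nat.le_add_right _ _
  · obtain ⟨a, ha, hB⟩ := h
    rw [ha]
    simp only [NormalState.size, BoundaryState.size]
    omega

/-- A closing run of length `c` can be an exact hit only for the index with `m k = c`. It is then a
new record, and appending it adds `c + 1 = m k + 1` to `B`. The extra 1 is the first `x`. -/
theorem sum_hit_lt_of_normalState {m : ℕ → ℕ} (hm : StrictMono m) (K : Finset ℕ)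
    (w : List Letter) :
    match NormalState.ofWord m w with
    | NormalState.pre a => a = w.length
    | NormalState.post B _ _ =>
        1 + ∑ k ∈ K, (m k + 1) * (ThresholdState.ofWord (m k) w).hit (m k) ≤ B := by
  induction w using List.reverseRecOn with
  | nil => simp
  | append_singleton w l ih =>
    have hT := thresholdState_of_normalState hm w
    simp only [NormalState.ofWord_append_singleton, ThresholdState.ofWord_append_singleton]
    generalize NormalState.ofWord m w = s at ih hT
    rcases s with a | ⟨B, M, c⟩ <;> rcases l with _ | _ <;> simp only [NormalState.step]
    · simp [hT, ThresholdState.step, ThresholdState.hit]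
    · simp [ih]
    · obtain ⟨-, hrun, hdone⟩ := hT
      have hold : ∀ k, k < M → ((ThresholdState.ofWord (m k) w).step (m k) Letter.x).hit (m k) =
          (ThresholdState.ofWord (m k) w).hit (m k) := by
        intro k hk
        obtain ⟨l, hl⟩ := hdone k hk
        rw [hl]
        rfl
      split_ifs with hM
      · have hsum : ∑ k ∈ K,
            (m k + 1) * ((ThresholdState.ofWord (m k) w).step (m k) Letter.x).hit (m k) ≤
            ∑ k ∈ K, ((m k + 1) * (ThresholdState.ofWord (m k) w).hit (m k) +
              if k = runType m c - 1 then c + 1 else 0) := by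
          refine Finset.sum_le_sum fun k _ => ?_
          rcases lt_or_ge k M with hk | hk
          · rw [hold k hk]
            exact Nat.le_add_right _ _
          · rw [hrun k hk]
            by_cases hc : m k = c
            · have h1 : runType m c ≤ k + 1 := (runType_le_iff hm).2 (hc ▸ hm (Nat.lt_succ_self k))
              have h2 : k < runType m c := (lt_runType_iff hm).2 hc.le
              rw [if_pos (by omega)]
              simp [ThresholdState.step, ThresholdState.hit, hc]
            · have : ((ThresholdState.run c).step (m k) Letter.x).hit (m k) = 0 := by
                simp only [ThresholdState.step]
                split_ifs
                · exact if_neg (by omega)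
                · rfl
              rw [this, mul_zero]
              exact Nat.zero_le _
        rw [Finset.sum_add_distrib, Finset.sum_ite_eq' K] at hsum
        split_ifs at hsum <;> omega
      · refine le_trans (Nat.add_le_add_left (Finset.sum_le_sum fun k _ => ?_) 1) ih
        rcases lt_or_ge k M with hk | hk
        · rw [hold k hk]
        · have h1 : c < m k := (runType_le_iff hm).1 (by omega)
          rw [hrun k hk]
          simp [ThresholdState.step, ThresholdState.hit, not_le.2 h1]
    · refine le_trans (le_of_eq ?_) ih
      congr 1
      refine Finset.sum_congr rfl fun k _ => ?_
      rcases ThresholdState.ofWord (m k) w with _ | c | l <;> rfl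

theorem sum_hit_lt_size_ofWord {m : ℕ → ℕ} (hm : StrictMono m) (K : Finset ℕ)
    (w : List Letter) (hw : w ≠ []) :
    1 + ∑ k ∈ K, (m k + 1) * (ThresholdState.ofWord (m k) w).hit (m k) ≤
      (NormalState.ofWord m w).size := by
  have h := sum_hit_lt_of_normalState hm K w
  have hT := thresholdState_of_normalState hm w
  generalize NormalState.ofWord m w = s at h hT
  rcases s with a | ⟨B, M, c⟩
  · have := List.length_pos_of_ne_nil hw
    simp only [NormalState.size, hT, ThresholdState.hit]
    simp
    omega
  · simp only [NormalState.size]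
    omega

theorem wordAvg_size_ofWord_le {m : ℕ → ℕ} (hm : StrictMono m) (h0 : m 0 = 1) (n : ℕ) :
    wordAvg n (fun w => ((NormalState.ofWord m w).size : ℝ)) ≤
      ∑ k ∈ upperIndices m n, ((m k : ℝ) + 2) * min 1 ((n : ℝ) / 2 ^ m k) + 3 := by
  have hK : ∀ k, m k + 2 ≤ n → k ∈ upperIndices m n := fun k hk => by
    rw [mem_upperIndices hm]
    omega
  have h1 : wordAvg n (fun w => ((NormalState.ofWord m w).size : ℝ)) ≤
      wordAvg n (fun w => ∑ k ∈ upperIndices m n, ((ThresholdState.ofWord (m k) w).gain : ℝ)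
        + ((BoundaryState.ofWord w).size : ℝ)) := by
    refine wordAvg_mono fun w hw => ?_
    have := size_ofWord_le_boundary_add_gain hm hK w hw.le
    rw [add_comm]
    exact_mod_cast this
  refine h1.trans ?_
  rw [wordAvg_add, wordAvg_sum]
  refine add_le_add (Finset.sum_le_sum fun k _ => ?_) (BoundaryState.wordAvg_size_le n)
  have hk : 1 ≤ m k := h0 ▸ hm.monotone (Nat.zero_le k)
  rw [mul_min_of_nonneg _ _ (by positivity), mul_one]
  exact le_min (ThresholdState.wordAvg_gain_le _ _) (ThresholdState.wordAvg_gain_le_mul hk n)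

theorem le_wordAvg_size_ofWord {m : ℕ → ℕ} (hm : StrictMono m) (h0 : m 0 = 1) (n : ℕ) :
    1 / 24 * ∑ k ∈ lowerIndices m n, ((m k : ℝ) + 1) ≤
      wordAvg n (fun w => ((NormalState.ofWord m w).size : ℝ)) := by
  rcases Nat.eq_zero_or_pos n with rfl | hn
  · simp [lowerIndices, wordAvg]
  -- The index 0 has threshold 1, too small for `ThresholdState.le_wordAvg_hit`. Its term `2 / 24`
  -- is covered by the spare 1 in `sum_hit_lt_size_ofWord`.
  set K := (lowerIndices m n).erase 0 with hKdef
  have h1 : wordAvg n (fun w => 1 + ∑ k ∈ K,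
      ((m k : ℝ) + 1) * ((ThresholdState.ofWord (m k) w).hit (m k) : ℝ)) ≤
      wordAvg n (fun w => ((NormalState.ofWord m w).size : ℝ)) := by
    refine wordAvg_mono fun w hw => ?_
    have := sum_hit_lt_size_ofWord hm K w (by rintro rfl; simp at hw; omega)
    exact_mod_cast this
  refine le_trans ?_ h1
  rw [wordAvg_add, wordAvg_const, wordAvg_sum]
  simp only [wordAvg_const_mul]
  have h2 : ∑ k ∈ lowerIndices m n, ((m k : ℝ) + 1) ≤ 2 + ∑ k ∈ K, ((m k : ℝ) + 1) := by
    by_cases h : 0 ∈ lowerIndices m n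
    · rw [← Finset.add_sum_erase _ _ h, h0]
      norm_num [hKdef]
    · rw [hKdef, Finset.erase_eq_of_notMem h]
      linarith
  have h3 : ∑ k ∈ K, 1 / 24 * ((m k : ℝ) + 1) ≤ ∑ k ∈ K, ((m k : ℝ) + 1) *
      wordAvg n (fun w => ((ThresholdState.ofWord (m k) w).hit (m k) : ℝ)) := by
    refine Finset.sum_le_sum fun k hk => ?_
    obtain ⟨hk0, hk⟩ := Finset.mem_erase.1 hk
    rw [mem_lowerIndices hm h0, Real.le_logb_iff_rpow_le (by norm_num) (by exact_mod_cast hn),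
      Real.rpow_natCast] at hk
    have hpow : 2 ^ m k ≤ n := by exact_mod_cast hk
    have hmk : 2 ≤ m k := by
      have := hm (Nat.pos_of_ne_zero hk0)
      omega
    rw [mul_comm]
    exact mul_le_mul_of_nonneg_left (ThresholdState.le_wordAvg_hit hmk hpow) (by positivity)
  rw [← Finset.mul_sum] at h3
  linarith

/-! ### The law of the random walk -/

namespace Sbar

theorem uniformOn_gens_singleton {m : ℕ → ℕ} (hm : StrictMono m) (h0 : m 0 = 1) {a : Sbar m}
    (ha : a ∈ gens m) : uniformOn (gens m) {a} = 2⁻¹ := by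
  classical
  have h := uniformOn_apply_finset (s := {x m, y m}) (t := {a})
  have hs : (({x m, y m} : Finset (Sbar m)) : Set (Sbar m)) = gens m := by simp [gens]
  have hi : ({x m, y m} ∩ {a} : Finset (Sbar m)) = {a} :=
    Finset.inter_singleton_of_mem (by simpa [gens] using ha)
  rw [hs, hi, Finset.card_singleton, Finset.card_pair (x_ne_y hm h0), Finset.coe_singleton] at h
  simpa using h

theorem ae_mem_gens {m : ℕ → ℕ} {Ω : Type*} [MeasurableSpace Ω] {μ : Measure Ω} {X : Ω → Sbar m}
    (hX : Measurable X) (hlaw : μ.map X = uniformOn (gens m)) : ∀ᵐ ω ∂μ, X ω ∈ gens m := by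
  have h : ∀ᵐ a ∂(μ.map X), a ∈ gens m := by
    rw [hlaw, uniformOn]
    exact ae_cond_mem (MeasurableSet.of_discrete)
  exact ae_of_ae_map hX.aemeasurable h

theorem integral_indicator_eq_half {m : ℕ → ℕ} (hm : StrictMono m) (h0 : m 0 = 1)
    {Ω : Type*} [MeasurableSpace Ω] {μ : Measure Ω} {X : Ω → Sbar m}
    (hX : Measurable X) (hlaw : μ.map X = uniformOn (gens m)) {a : Sbar m} (ha : a ∈ gens m) :
    ∫ ω, (X ⁻¹' {a}).indicator (fun _ => (1 : ℝ)) ω ∂μ = 1 / 2 := by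
  rw [integral_indicator (hX MeasurableSet.of_discrete), setIntegral_const, measureReal_def,
    ← Measure.map_apply hX MeasurableSet.of_discrete, hlaw, uniformOn_gens_singleton hm h0 ha]
  simp

/-- The expectation of a function of the position of the random walk is an average over words. -/
theorem integral_randomWalk {m : ℕ → ℕ} (hm : StrictMono m) (h0 : m 0 = 1) {Ω : Type*}
    [MeasurableSpace Ω] {μ : Measure Ω} [IsProbabilityMeasure μ] {R : ℕ → Ω → Sbar m}
    (hR : IsSimpleRandomWalk (gens m) μ R) (n : ℕ) (F : Sbar m → ℝ) :
    Integrable (fun ω => F (R n ω)) μ ∧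
      ∫ ω, F (R n ω) ∂μ = wordAvg n (fun w => F (ofWord m w)) := by
  obtain ⟨X, hX, hind, hlaw, hprod⟩ := hR
  have hmeas : ∀ n, Measurable (R n) := by
    intro n
    have : R n = (fun v : Fin n → Sbar m => (List.ofFn v).prod) ∘ fun ω i => X i ω :=
      funext fun ω => hprod n ω
    rw [this]
    exact Measurable.of_discrete.comp (measurable_pi_lambda _ fun i => hX i)
  have hsucc : ∀ n ω, R (n + 1) ω = R n ω * X n ω := by
    intro n ω
    rw [hprod, hprod, List.ofFn_succ', List.concat_eq_append, List.prod_append]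
    simp
  have hindep : ∀ n, IndepFun (R n) (X n) μ := by
    intro n
    have h := hind.indepFun_finset (Finset.range n) {n} (by simp) hX
    let φ : ((i : Finset.range n) → Sbar m) → Sbar m := fun v =>
      (List.ofFn fun i : Fin n => v ⟨i, Finset.mem_range.2 i.2⟩).prod
    let ψ : ((i : ({n} : Finset ℕ)) → Sbar m) → Sbar m := fun v => v ⟨n, by simp⟩
    have h' := h.comp (φ := φ) (ψ := ψ) Measurable.of_discrete Measurable.of_discrete
    have hφ : R n = φ ∘ fun ω (i : Finset.range n) => X i ω := funext fun ω => hprod n ω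
    rw [hφ]
    exact h'
  induction n generalizing F with
  | zero =>
    have : ∀ ω, R 0 ω = 1 := fun ω => by simp [hprod]
    simp [this, wordAvg]
  | succ n ih =>
    -- Conditioning on the last increment: independence splits off a factor 1/2, and the induction
    -- hypothesis applies to the translate `g ↦ F (g * a)`.
    have hpart : ∀ a ∈ gens m,
        Integrable (fun ω => F (R n ω * a) * (X n ⁻¹' {a}).indicator (fun _ => (1 : ℝ)) ω) μ ∧
        ∫ ω, F (R n ω * a) * (X n ⁻¹' {a}).indicator (fun _ => (1 : ℝ)) ω ∂μ =
          wordAvg n (fun w => F (ofWord m w * a)) / 2 := by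
      intro a ha
      have h1 : IndepFun (fun ω => F (R n ω * a))
          (fun ω => (X n ⁻¹' {a}).indicator (fun _ => (1 : ℝ)) ω) μ :=
        (hindep n).comp (φ := fun g => F (g * a))
          (ψ := fun g => ({a} : Set (Sbar m)).indicator (fun _ => (1 : ℝ)) g)
          Measurable.of_discrete Measurable.of_discrete
      obtain ⟨h2, h3⟩ := ih (fun g => F (g * a))
      have h4 : Integrable (fun ω => (X n ⁻¹' {a}).indicator (fun _ => (1 : ℝ)) ω) μ :=
        (integrable_const 1).indicator (hX n MeasurableSet.of_discrete)
      refine ⟨h1.integrable_mul h2 h4, ?_⟩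
      rw [h1.integral_fun_mul_eq_mul_integral h2.aestronglyMeasurable h4.aestronglyMeasurable,
        h3, integral_indicator_eq_half hm h0 (hX n) (hlaw n) ha]
      ring
    obtain ⟨hx1, hx2⟩ := hpart (x m) (Or.inl rfl)
    obtain ⟨hy1, hy2⟩ := hpart (y m) (Or.inr rfl)
    have hae : (fun ω => F (R n ω * x m) * (X n ⁻¹' {x m}).indicator (fun _ => (1 : ℝ)) ω +
        F (R n ω * y m) * (X n ⁻¹' {y m}).indicator (fun _ => (1 : ℝ)) ω) =ᵐ[μ]
        fun ω => F (R (n + 1) ω) := by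
      filter_upwards [ae_mem_gens (hX n) (hlaw n)] with ω hω
      have hxy := x_ne_y hm h0
      rw [hsucc]
      rcases hω with h | h
      · simp [h, hxy]
      · rw [Set.mem_singleton_iff] at h
        simp [h, hxy.symm]
    refine ⟨(hx1.add hy1).congr hae, ?_⟩
    rw [← integral_congr_ae hae, integral_add hx1 hy1, hx2, hy2]
    simp only [wordAvg, ofWord_append, ofWord_x, ofWord_y]
    ring

end Sbar

theorem mainTheorem9 :
    ∃ c₀ : ℝ, 0 < c₀ ∧
      ∀ (m : ℕ → ℕ), StrictMono m → m 0 = 1 →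
      ∀ (Ω : Type*) [MeasurableSpace Ω] (μ : Measure Ω) [IsProbabilityMeasure μ]
        (R : ℕ → Ω → Sbar m), IsSimpleRandomWalk (Sbar.gens m) μ R →
      ∀ n : ℕ,
        Integrable (fun ω => (wordLength (Sbar.gens m) (R n ω) : ℝ)) μ ∧
        c₀ * ∑ k ∈ lowerIndices m n, ((m k : ℝ) + 1)
            ≤ ∫ ω, (wordLength (Sbar.gens m) (R n ω) : ℝ) ∂μ ∧
        ∫ ω, (wordLength (Sbar.gens m) (R n ω) : ℝ) ∂μ
            ≤ ∑ k ∈ upperIndices m n, ((m k : ℝ) + 2) * min 1 ((n : ℝ) / 2 ^ m k) + 3 := by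
  refine ⟨1 / 24, by norm_num, ?_⟩
  intro m hm h0 Ω _ μ _ R hR n
  obtain ⟨h1, h2⟩ :=
    Sbar.integral_randomWalk hm h0 hR n (fun g => (wordLength (Sbar.gens m) g : ℝ))
  simp only [Sbar.wordLength_ofWord hm h0] at h2
  refine ⟨h1, ?_, ?_⟩
  · rw [h2]
    exact le_wordAvg_size_ofWord hm h0 n
  · rw [h2]
    exact wordAvg_size_ofWord_le hm h0 n
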